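/- Let $m,n$ be positive integers and $U=\{1,2,\dots,m+n\}$. For a finite set $X=\{x_1<x_2<\dots<x_k\}$ of nonnegative integers, let $V_X=\prod_{1\le i<j\le k}(x_j-x_i)$ be its Vandermonde determinant (an empty product is $1$), and for an integer $k\ge 1$ let $G(k+1)=(k-1)!\,(k-2)!\cdots 1!$ be the value of the Barnes $G$-function at $k+1$ (so $G(2)=1$). Let $t$ be an integer with $$\frac{m(m+1)}{2}\le t\le \frac{m(m+1)}{2}+mn,$$ and put $t^*=t-\frac{m(m+1)}{2}$. Then $$\sum_{\substack{X\subset U,\ |X|=m\\ \sum_{x\in X}x=t}} V_X\,V_{U\setminus X}=G(m+1)\,G(n+1)\binom{mn}{t^*},$$ where the sum is over all $m$-element subsets $X$ of $U$ whose elements sum to $t$. -/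

import Mathlib

/-- The Barnes `G`-function at the natural numbers: `G 0 = 0` and
`G (m + 1) = 0! * 1! * ⋯ * (m - 1)!`. -/
def barnesG : ℕ → ℕ
  | 0 => 0
  | m + 1 => ∏ i ∈ Finset.range m, Nat.factorial i

/-- The Vandermonde determinant `V_X = ∏ (x_j - x_i)`, over `i < j`, of a finite set
`X = {x_0 < x_1 < ⋯}` of natural numbers, listed in increasing order. It is an integer. -/
def vandermondeOf (X : Finset ℕ) : ℤ :=
  ∏ i : Fin X.card, ∏ j ∈ Finset.Ioi i,
    (((X.orderEmbOfFin rfl j : ℕ) : ℤ) - ((X.orderEmbOfFin rfl i : ℕ) : ℤ))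

/-- `V_X` is the determinant of the Vandermonde matrix of the increasing listing of `X`. -/
theorem vandermondeOf_eq_det (X : Finset ℕ) :
    vandermondeOf X =
      (Matrix.vandermonde fun i : Fin X.card => ((X.orderEmbOfFin rfl i : ℕ) : ℤ)).det :=
  (Matrix.det_vandermonde _).symm

/-!
The sums over all `t` are handled at once, through the generating function
`∑ V_X V_{U \ X} q ^ (∑ X)`. By `det_vandermonde_eq_mul_det_choose`, the Vandermonde determinant
of a `k`-element set `X` is `G (k + 1)` times the determinant of the binomial coefficients
`x.choose j`, for `x ∈ X` and `j < k`. Hence, up to signs and powers of `q`, the generating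
function is the Laplace expansion (`det_append_eq_sum`) along the first `m` columns of the
confluent Vandermonde matrix whose row `x` (for `0 ≤ x < m + n`) consists of the first `m` Hasse
derivatives of the monomial `T ^ x` at `T = a` and its first `n` Hasse derivatives at `T = 1`.

Replacing the monomials by the monic polynomials `(T - a) ^ k` for `k < m` and
`(T - a) ^ m * (T - 1) ^ l` for `l < n` does not change the determinant and makes the matrix block
triangular, so the determinant is `(1 - a) ^ (m * n)` (`det_confluent`). The Laplace sign attached
to a set `X` is `(-1)` to the power `∑ X - m (m - 1) / 2` (`sign_shufflePerm`), with the elements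
of `X` counted from `0`; the choice `a = -q` therefore removes all signs and gives
`q ^ (m (m - 1) / 2) * (1 + q) ^ (m * n)` (`sum_det_choose_mul_X_pow`). The binomial coefficient
`(m * n).choose t*` is a coefficient of this polynomial.
-/

/-! ### The confluent Vandermonde determinant -/

open Polynomial in
theorem det_coeff_of_monic {R : Type*} [CommRing R] {N : ℕ} (p : Fin N → R[X])
    (hdeg : ∀ k, (p k).natDegree = k) (hmonic : ∀ k, (p k).Monic) :
    (Matrix.of fun k x : Fin N => (p k).coeff x).det = 1 := by
  rw [Matrix.det_of_isLowerTriangular]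
  · refine Finset.prod_eq_one fun k _ => ?_
    have := hmonic k
    rwa [Monic, leadingCoeff, hdeg] at this
  · intro i j hij
    exact coeff_eq_zero_of_natDegree_lt (by rw [hdeg]; exact hij)

open Polynomial in
/-- The `i`-th Hasse derivative of `p` at `a` (a Taylor coefficient), expanded over the
coefficients of `p`. For `x < i` the truncated exponent `x - i` is harmless, as
`x.choose i = 0`. -/
theorem sum_coeff_mul_taylor_coeff {R : Type*} [CommRing R] {N : ℕ} (p : R[X])
    (hp : p.natDegree < N) (a : R) (i : ℕ) :
    ∑ x : Fin N, p.coeff x * ((x : ℕ).choose i * a ^ ((x : ℕ) - i)) = (taylor a p).coeff i := by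
  conv_rhs => rw [p.as_sum_range' N hp]
  rw [map_sum, finsetSum_coeff, Finset.sum_range]
  refine Finset.sum_congr rfl fun x _ => ?_
  rw [taylor_monomial, coeff_C_mul, coeff_X_add_C_pow]
  ring

open Polynomial in
/-- The confluent Vandermonde determinant with a node `a` of multiplicity `m` and a node `1` of
multiplicity `n`: row `x` lists the Hasse derivatives of `T ^ x` at the two nodes. -/
theorem det_confluent {R : Type*} [CommRing R] [Nontrivial R] (m n : ℕ) (a : R) :
    (Matrix.of fun x : Fin (m + n) => Fin.append
      (fun i : Fin m => ((x : ℕ).choose i : R) * a ^ ((x : ℕ) - i))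
      (fun i : Fin n => ((x : ℕ).choose i : R))).det = (1 - a) ^ (m * n) := by
  set K := Matrix.of fun x : Fin (m + n) => Fin.append
      (fun i : Fin m => ((x : ℕ).choose i : R) * a ^ ((x : ℕ) - i))
      (fun i : Fin n => ((x : ℕ).choose i : R)) with hK
  -- In this basis, Taylor expansion at `a` kills the lower left block, and expansion at `1` makes
  -- the lower right block triangular with diagonal entries `(1 - a) ^ m`.
  let p : Fin (m + n) → R[X] := Fin.append (fun k : Fin m => (X - C a) ^ (k : ℕ))
    (fun l : Fin n => (X - C a) ^ m * (X - C 1) ^ (l : ℕ))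
  have hmonic : ∀ k, (p k).Monic := by
    intro k
    refine Fin.addCases (fun k => ?_) (fun l => ?_) k
    · simpa [p] using (monic_X_sub_C a).pow _
    · simpa only [p, Fin.append_right] using
        ((monic_X_sub_C a).pow _).mul ((monic_X_sub_C 1).pow _)
  have hdeg : ∀ k, (p k).natDegree = k := by
    intro k
    refine Fin.addCases (fun k => ?_) (fun l => ?_) k
    · simp only [p, Fin.append_left, Fin.val_castAdd,
        (monic_X_sub_C a).natDegree_pow, natDegree_X_sub_C, mul_one]
    · simp only [p, Fin.append_right, Fin.val_natAdd,
        ((monic_X_sub_C a).pow m).natDegree_mul ((monic_X_sub_C (1 : R)).pow l),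
        (monic_X_sub_C _).natDegree_pow, natDegree_X_sub_C, mul_one]
  have hleft : ∀ k i, ((Matrix.of fun k x : Fin (m + n) => (p k).coeff x) * K) k (Fin.castAdd n i)
      = (taylor a (p k)).coeff i := by
    intro k i
    rw [← sum_coeff_mul_taylor_coeff (p k) ((hdeg k).trans_lt k.2)]
    simp [Matrix.mul_apply, hK]
  have hright : ∀ k i, ((Matrix.of fun k x : Fin (m + n) => (p k).coeff x) * K) k (Fin.natAdd m i)
      = (taylor 1 (p k)).coeff i := by
    intro k i
    rw [← sum_coeff_mul_taylor_coeff (p k) ((hdeg k).trans_lt k.2)]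
    simp [Matrix.mul_apply, hK]
  have htX : ∀ b c : R, taylor b (X - C c) = X + C (b - c) := by
    intro b c
    simp [add_sub_assoc]
  have hdet : K.det = ((Matrix.of fun k x : Fin (m + n) => (p k).coeff x) * K).det := by
    rw [Matrix.det_mul, det_coeff_of_monic p hdeg hmonic, one_mul]
  rw [hdet, ← Matrix.det_submatrix_equiv_self finSumFinEquiv, ← Matrix.fromBlocks_toBlocks
      (Matrix.submatrix _ _ _)]
  have h11 : (((Matrix.of fun k x : Fin (m + n) => (p k).coeff x) * K).submatrix finSumFinEquiv
      finSumFinEquiv).toBlocks₁₁ = 1 := by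
    ext k i
    simp only [Matrix.toBlocks₁₁, Matrix.of_apply, Matrix.submatrix_apply,
      finSumFinEquiv_apply_left, hleft, p, Fin.append_left, taylor_pow, htX, sub_self, C_0,
      add_zero, coeff_X_pow, Matrix.one_apply, Fin.ext_iff, eq_comm]
  have h21 : (((Matrix.of fun k x : Fin (m + n) => (p k).coeff x) * K).submatrix finSumFinEquiv
      finSumFinEquiv).toBlocks₂₁ = 0 := by
    ext l i
    simp only [Matrix.toBlocks₂₁, Matrix.of_apply, Matrix.submatrix_apply,
      finSumFinEquiv_apply_left, finSumFinEquiv_apply_right, hleft, p, Fin.append_right,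
      taylor_mul, taylor_pow, htX, sub_self, C_0, add_zero, coeff_X_pow_mul', not_le.mpr i.2,
      if_false, Matrix.zero_apply]
  have h22 : ∀ l i, (((Matrix.of fun k x : Fin (m + n) => (p k).coeff x) * K).submatrix finSumFinEquiv
      finSumFinEquiv).toBlocks₂₂ l i =
        if (l : ℕ) ≤ i then ((X + C (1 - a)) ^ m).coeff (i - l : ℕ) else 0 := by
    intro l i
    simp only [Matrix.toBlocks₂₂, Matrix.of_apply, Matrix.submatrix_apply,
      finSumFinEquiv_apply_right, hright, p, Fin.append_right,
      taylor_mul, taylor_pow, htX, sub_self, C_0, add_zero, coeff_mul_X_pow']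
  rw [h11, h21, Matrix.det_fromBlocks_zero₂₁, Matrix.det_one, one_mul,
    Matrix.det_of_isUpperTriangular]
  · simp only [h22, le_refl, if_true, Nat.sub_self, coeff_X_add_C_pow, Nat.sub_zero,
      Nat.choose_zero_right, Nat.cast_one, mul_one, Finset.prod_const, Finset.card_univ,
      Fintype.card_fin, pow_mul]
  · intro l i hil
    have hlt : (i : ℕ) < l := hil
    rw [h22, if_neg (not_le.mpr hlt)]

/-! ### The Laplace expansion along two blocks of columns -/

/-- The permutation of `Fin (m + n)` listing first `s`, then its complement, both increasingly. -/
def shufflePerm {m n : ℕ} {s : Finset (Fin (m + n))} (hs : s.card = m) (hs' : sᶜ.card = n) :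
    Equiv.Perm (Fin (m + n)) :=
  finSumFinEquiv.symm.trans (finSumEquivOfFinset hs hs')

theorem shufflePerm_castAdd {m n : ℕ} {s : Finset (Fin (m + n))} (hs : s.card = m)
    (hs' : sᶜ.card = n) (i : Fin m) :
    shufflePerm hs hs' (Fin.castAdd n i) = s.orderEmbOfFin hs i := by
  simp [shufflePerm]

theorem shufflePerm_natAdd {m n : ℕ} {s : Finset (Fin (m + n))} (hs : s.card = m)
    (hs' : sᶜ.card = n) (i : Fin n) :
    shufflePerm hs hs' (Fin.natAdd m i) = sᶜ.orderEmbOfFin hs' i := by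
  simp [shufflePerm]

theorem prod_orderEmbOfFin {α M : Type*} [LinearOrder α] [CommMonoid M] {k : ℕ} (s : Finset α)
    (h : s.card = k) (f : α → M) : ∏ i, f (s.orderEmbOfFin h i) = ∏ x ∈ s, f x := by
  conv_rhs => rw [← s.map_orderEmbOfFin_univ h, Finset.prod_map]
  rfl

theorem sum_orderEmbOfFin {α M : Type*} [LinearOrder α] [AddCommMonoid M] {k : ℕ} (s : Finset α)
    (h : s.card = k) (f : α → M) : ∑ i, f (s.orderEmbOfFin h i) = ∑ x ∈ s, f x := by
  conv_rhs => rw [← s.map_orderEmbOfFin_univ h, Finset.sum_map]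
  rfl

theorem prod_ite_lt_neg_one {N : ℕ} (x : Fin N) :
    ∏ y : Fin N, (if y < x then (-1 : ℤ) else 1) = (-1) ^ (x : ℕ) := by
  rw [← Finset.prod_filter, Finset.prod_const]
  congr 1
  have : Finset.univ.filter (fun y => y < x) = Finset.Iio x := by ext; simp
  rw [this, Fin.card_Iio]

/-- The sign of a shuffle counts its inversions, the pairs `y < x` with `x ∈ s` and `y ∉ s`. -/
theorem sign_shufflePerm_eq_prod {m n : ℕ} {s : Finset (Fin (m + n))} (hs : s.card = m)
    (hs' : sᶜ.card = n) :
    ((Equiv.Perm.sign (shufflePerm hs hs') : ℤˣ) : ℤ) =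
      ∏ x ∈ s, ∏ y ∈ sᶜ, if y < x then -1 else 1 := by
  have hIoi : ∀ i : Fin (m + n), Finset.Ioi i = Finset.univ.filter (fun j => i < j) := by
    intro i; ext; simp
  rw [Equiv.Perm.sign_eq_prod_prod_Ioi]
  simp only [hIoi, Finset.prod_filter, Fin.prod_univ_add, shufflePerm_castAdd,
    shufflePerm_natAdd, OrderEmbedding.lt_iff_lt]
  rw [← prod_orderEmbOfFin s hs]
  simp_rw [← prod_orderEmbOfFin sᶜ hs']
  have h1 : ∀ i j : Fin m, (if Fin.castAdd n i < Fin.castAdd n j then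
      (if i < j then (1 : ℤˣ) else -1) else 1) = 1 := by
    intro i j
    simp only [Fin.lt_def, Fin.val_castAdd]
    split_ifs <;> rfl
  have h2 : ∀ i j : Fin n, (if Fin.natAdd m i < Fin.natAdd m j then
      (if i < j then (1 : ℤˣ) else -1) else 1) = 1 := by
    intro i j
    simp only [Fin.lt_def, Fin.val_natAdd, add_lt_add_iff_left]
    split_ifs <;> rfl
  have h3 : ∀ (i : Fin m) (j : Fin n), Fin.castAdd n i < Fin.natAdd m j := by
    intro i j
    simp only [Fin.lt_def, Fin.val_castAdd, Fin.val_natAdd]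
    omega
  have h4 : ∀ (i : Fin m) (j : Fin n), s.orderEmbOfFin hs i ≠ sᶜ.orderEmbOfFin hs' j := by
    intro i j h
    exact Finset.mem_compl.mp (sᶜ.orderEmbOfFin_mem hs' j) (h ▸ s.orderEmbOfFin_mem hs i)
  simp only [h1, h2, h3, (h3 _ _).not_gt, if_true, if_false, Finset.prod_const_one, one_mul,
    mul_one]
  push_cast
  refine Finset.prod_congr rfl fun i _ => Finset.prod_congr rfl fun j _ => ?_
  rcases (h4 i j).lt_or_gt with h | h
  · simp [h, h.not_gt]
  · simp [h, h.not_gt]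

/-- The sign of the shuffle of `s` is `(-1) ^ (∑ s - m (m - 1) / 2)`: each `x ∈ s` exceeds exactly
`x` elements of `Fin (m + n)`, and the pairs inside `s` account for `0 + 1 + ⋯ + (m - 1)` of
these. -/
theorem sign_shufflePerm {m n : ℕ} {s : Finset (Fin (m + n))} (hs : s.card = m)
    (hs' : sᶜ.card = n) :
    ((Equiv.Perm.sign (shufflePerm hs hs') : ℤˣ) : ℤ) * (-1) ^ (∑ i : Fin m, (i : ℕ)) =
      (-1) ^ (∑ x ∈ s, (x : ℕ)) := by
  have h : (-1 : ℤ) ^ (∑ i : Fin m, (i : ℕ)) = ∏ x ∈ s, ∏ y ∈ s, if y < x then -1 else 1 := by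
    rw [← prod_orderEmbOfFin s hs]
    simp_rw [← prod_orderEmbOfFin s hs, OrderEmbedding.lt_iff_lt, prod_ite_lt_neg_one]
    rw [Finset.prod_pow_eq_pow_sum]
  rw [sign_shufflePerm_eq_prod, h, ← Finset.prod_mul_distrib, ← Finset.prod_pow_eq_pow_sum]
  refine Finset.prod_congr rfl fun x _ => ?_
  rw [Finset.prod_compl_mul_prod, prod_ite_lt_neg_one]

theorem det_piecewise_append {R : Type*} [CommRing R] {m n : ℕ} (A : Fin (m + n) → Fin m → R)
    (B : Fin (m + n) → Fin n → R) {s : Finset (Fin (m + n))} (hs : s.card = m)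
    (hs' : sᶜ.card = n) :
    (Matrix.of (s.piecewise (fun x => Fin.append (A x) 0) (fun x => Fin.append 0 (B x)))).det =
      ((Equiv.Perm.sign (shufflePerm hs hs') : ℤˣ) : ℤ) *
        ((Matrix.of fun i => A (s.orderEmbOfFin hs i)).det *
          (Matrix.of fun i => B (sᶜ.orderEmbOfFin hs' i)).det) := by
  set M := Matrix.of (s.piecewise (fun x => Fin.append (A x) 0) (fun x => Fin.append 0 (B x)))
    with hM
  have hin : ∀ i, s.orderEmbOfFin hs i ∈ s := s.orderEmbOfFin_mem hs
  have hout : ∀ i, sᶜ.orderEmbOfFin hs' i ∉ s := fun i =>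
    Finset.mem_compl.mp (sᶜ.orderEmbOfFin_mem hs' i)
  have hblocks : ((M.submatrix (shufflePerm hs hs') id).submatrix finSumFinEquiv
      finSumFinEquiv) = Matrix.fromBlocks (Matrix.of fun i => A (s.orderEmbOfFin hs i)) 0 0
        (Matrix.of fun i => B (sᶜ.orderEmbOfFin hs' i)) := by
    ext i j
    rcases i with i | i <;> rcases j with j | j <;>
      simp [hM, shufflePerm_castAdd, shufflePerm_natAdd, hin, hout]
  have hdet := Matrix.det_permute (shufflePerm hs hs') M
  rw [← Matrix.det_submatrix_equiv_self finSumFinEquiv (M.submatrix _ _), hblocks,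
    Matrix.det_fromBlocks_zero₂₁] at hdet
  rw [hdet, ← mul_assoc, ← Int.cast_mul, ← Units.val_mul, Int.units_mul_self]
  simp

/-- If `s.card ≠ m`, no permutation matches `s` with the first `m` columns, so every term of the
Leibniz formula has a zero factor. -/
theorem det_piecewise_append_eq_zero {R : Type*} [CommRing R] {m n : ℕ}
    (A : Fin (m + n) → Fin m → R) (B : Fin (m + n) → Fin n → R) {s : Finset (Fin (m + n))}
    (hs : s.card ≠ m) :
    (Matrix.of (s.piecewise (fun x => Fin.append (A x) 0) (fun x => Fin.append 0 (B x)))).det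
      = 0 := by
  rw [Matrix.det_apply]
  refine Finset.sum_eq_zero fun σ _ => ?_
  by_contra hne
  apply hs
  have hne' : ∀ k, (s.piecewise (fun x => Fin.append (A x) 0) (fun x => Fin.append 0 (B x)))
      (σ k) k ≠ 0 := by
    intro k hk
    refine hne ?_
    have hprod := Finset.prod_eq_zero (f := fun k => Matrix.of (s.piecewise
      (fun x => Fin.append (A x) 0) (fun x => Fin.append 0 (B x))) (σ k) k) (Finset.mem_univ k) hk
    rw [hprod, smul_zero]
  have hs_eq : s = Finset.univ.map ((Fin.castAddEmb n).trans σ.toEmbedding) := by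
    ext x
    obtain ⟨k, rfl⟩ := σ.surjective x
    have := hne' k
    revert this
    refine Fin.addCases (fun k => ?_) (fun k => ?_) k
    · by_cases hk : σ (Fin.castAdd n k) ∈ s <;> simp [hk]
    · by_cases hk : σ (Fin.natAdd m k) ∈ s
      · simp [hk]
      · simp [hk, Fin.ext_iff]
        omega
  rw [hs_eq]
  simp

theorem card_compl_of_card_eq {m n : ℕ} {s : Finset (Fin (m + n))} (hs : s.card = m) :
    sᶜ.card = n := by
  rw [Finset.card_compl, Fintype.card_fin, hs, Nat.add_sub_cancel_left]

/-- Laplace expansion along the first `m` columns. The rows are split as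
`(A x, 0) + (0, B x)`, and the determinant is expanded multilinearly over the set `s` of rows
in which the first summand is chosen. -/
theorem det_append_eq_sum {R : Type*} [CommRing R] {m n : ℕ} (A : Fin (m + n) → Fin m → R)
    (B : Fin (m + n) → Fin n → R) :
    (Matrix.of fun x => Fin.append (A x) (B x)).det =
      ∑ s : Finset (Fin (m + n)), if h : s.card = m then
        ((Equiv.Perm.sign (shufflePerm h (card_compl_of_card_eq h)) : ℤˣ) : ℤ) *
          ((Matrix.of fun i => A (s.orderEmbOfFin h i)).det *
            (Matrix.of fun i => B (sᶜ.orderEmbOfFin (card_compl_of_card_eq h) i)).det)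
        else 0 := by
  have hsplit : (fun x => Fin.append (A x) (B x)) =
      (fun x => Fin.append (A x) (0 : Fin n → R)) + fun x => Fin.append (0 : Fin m → R) (B x) := by
    ext x j
    refine Fin.addCases (fun j => ?_) (fun j => ?_) j <;> simp
  rw [hsplit]
  refine (Matrix.detRowAlternating.toMultilinearMap.map_add_univ _ _).trans ?_
  refine Finset.sum_congr rfl fun s _ => ?_
  split_ifs with h
  · exact det_piecewise_append A B h _
  · exact det_piecewise_append_eq_zero A B h

/-! ### Vandermonde determinants and binomial coefficients -/

theorem det_choose_mul_pow {R : Type*} [CommRing R] {k : ℕ} (v : Fin k → ℕ) (a : R) :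
    (Matrix.of fun i j : Fin k => ((v i).choose j : R) * a ^ (v i - j)).det *
        a ^ (∑ j : Fin k, (j : ℕ)) =
      a ^ (∑ i, v i) * (Matrix.of fun i j : Fin k => ((v i).choose j : R)).det := by
  rw [← Finset.prod_pow_eq_pow_sum, ← Finset.prod_pow_eq_pow_sum, mul_comm,
    ← Matrix.det_mul_row, ← Matrix.det_mul_column]
  congr 1
  ext i j
  simp only [Matrix.of_apply]
  rcases le_or_gt (j : ℕ) (v i) with h | h
  · rw [mul_left_comm, ← pow_add, Nat.add_sub_cancel' h, mul_comm]
  · simp [Nat.choose_eq_zero_of_lt h]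

/-- The monomials may be replaced by the falling factorials, which are monic of the same degrees
and equal to `j ! * x.choose j`. -/
theorem det_vandermonde_eq_mul_det_choose {k : ℕ} (v : Fin k → ℕ) :
    (Matrix.vandermonde fun i => (v i : ℤ)).det =
      (barnesG (k + 1) : ℤ) * (Matrix.of fun i j : Fin k => ((v i).choose j : ℤ)).det := by
  rw [Matrix.det_eval_matrixOfPolynomials_eq_det_vandermonde _ (fun i => descPochhammer ℤ i)
    (fun i => descPochhammer_natDegree ℤ i) (fun i => monic_descPochhammer ℤ i)]
  rw [barnesG, Finset.prod_range, Nat.cast_prod, ← Matrix.det_mul_row]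
  congr 1
  ext i j
  simp only [Matrix.of_apply]
  rw [descPochhammer_eval_eq_descFactorial, Nat.descFactorial_eq_factorial_mul_choose,
    Nat.cast_mul]

theorem vandermondeOf_eq_det_of_card {X : Finset ℕ} {k : ℕ} (h : X.card = k) :
    vandermondeOf X = (Matrix.vandermonde fun i : Fin k => ((X.orderEmbOfFin h i : ℕ) : ℤ)).det := by
  subst h
  exact vandermondeOf_eq_det X

/-- The increasing bijection `x ↦ x + 1` of `Fin N` onto `{1, …, N}`, as an embedding into `ℕ`. -/
def finSuccEmb (N : ℕ) : Fin N ↪ ℕ := ⟨fun x => x + 1, fun x y h => by simpa [Fin.ext_iff] using h⟩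

theorem vandermondeOf_map_finSuccEmb {N k : ℕ} (s : Finset (Fin N)) (h : s.card = k) :
    vandermondeOf (s.map (finSuccEmb N)) = (barnesG (k + 1) : ℤ) *
      (Matrix.of fun i j : Fin k => ((s.orderEmbOfFin h i : ℕ).choose j : ℤ)).det := by
  have hcard : (s.map (finSuccEmb N)).card = k := by rw [Finset.card_map, h]
  have hemb : (fun i => (s.orderEmbOfFin h i : ℕ) + 1) =
      (s.map (finSuccEmb N)).orderEmbOfFin hcard := by
    refine Finset.orderEmbOfFin_unique hcard
      (fun i => Finset.mem_map_of_mem (finSuccEmb N) (s.orderEmbOfFin_mem h i)) fun i j hij => ?_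
    have : (s.orderEmbOfFin h i : ℕ) < s.orderEmbOfFin h j := (s.orderEmbOfFin h).strictMono hij
    omega
  rw [vandermondeOf_eq_det_of_card hcard, ← hemb, ← det_vandermonde_eq_mul_det_choose]
  simp only [Nat.cast_add, Nat.cast_one]
  exact Matrix.det_vandermonde_add _ 1

/-! ### The generating function -/

open Polynomial in
/-- The generating function: the Laplace expansion of `det_confluent` at `a = -X`, where the
Laplace signs cancel against those of the powers of `-X`. -/
theorem sum_det_choose_mul_X_pow (m n : ℕ) :
    ∑ s : Finset (Fin (m + n)), (if h : s.card = m then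
        C ((Matrix.of fun i j : Fin m => ((s.orderEmbOfFin h i : ℕ).choose j : ℤ)).det *
          (Matrix.of fun i j : Fin n =>
            ((sᶜ.orderEmbOfFin (card_compl_of_card_eq h) i : ℕ).choose j : ℤ)).det) *
          X ^ (∑ x ∈ s, (x : ℕ)) else 0) =
      (X : ℤ[X]) ^ (∑ i : Fin m, (i : ℕ)) * (1 + X) ^ (m * n) := by
  have hK := det_confluent m n (-X : ℤ[X])
  rw [det_append_eq_sum, sub_neg_eq_add] at hK
  rw [← hK, Finset.mul_sum]
  refine Finset.sum_congr rfl fun s _ => ?_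
  split_ifs with h
  · have hcast : ∀ {k : ℕ} (v : Fin k → ℕ), (Matrix.of fun i j : Fin k =>
        ((v i).choose j : ℤ[X])).det = C (Matrix.of fun i j : Fin k => ((v i).choose j : ℤ)).det := by
      intro k v
      rw [RingHom.map_det]
      congr 1
    have hA := det_choose_mul_pow (fun i => (s.orderEmbOfFin h i : ℕ)) (-X : ℤ[X])
    have hsgn := congrArg (Int.cast : ℤ → ℤ[X]) (sign_shufflePerm h (card_compl_of_card_eq h))
    push_cast at hsgn
    rw [hcast, sum_orderEmbOfFin s h (fun x => (x : ℕ)), neg_pow, neg_pow (X : ℤ[X]) (∑ x ∈ s, _),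
      ← hsgn] at hA
    rw [hcast, C_mul]
    have h1 : ((-1 : ℤ[X]) ^ (∑ i : Fin m, (i : ℕ))) * (-1) ^ (∑ i : Fin m, (i : ℕ)) = 1 := by
      rw [← mul_pow]; simp
    set ε : ℤ[X] :=
      (((Equiv.Perm.sign (shufflePerm h (card_compl_of_card_eq h)) : ℤˣ) : ℤ) : ℤ[X]) with hε
    have h2 : ε * ε = 1 := by
      rw [hε, ← Int.cast_mul, ← Units.val_mul, Int.units_mul_self]; simp
    set δ : ℤ[X] := (-1 : ℤ[X]) ^ (∑ i : Fin m, (i : ℕ))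
    set P : ℤ[X] := X ^ (∑ i : Fin m, (i : ℕ))
    set Q : ℤ[X] := X ^ (∑ x ∈ s, (x : ℕ))
    set D := (Matrix.of fun i j : Fin m => ((s.orderEmbOfFin h i : ℕ).choose j : ℤ[X]) *
      (-X) ^ ((s.orderEmbOfFin h i : ℕ) - j)).det
    set α := C (Matrix.of fun i j : Fin m => ((s.orderEmbOfFin h i : ℕ).choose j : ℤ)).det
    set β := C (Matrix.of fun i j : Fin n =>
      ((sᶜ.orderEmbOfFin (card_compl_of_card_eq h) i : ℕ).choose j : ℤ)).det
    linear_combination -(ε * δ * β) * hA + (P * ε * D * β) * h1 -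
      (ε * ε * h1 + h2) * (Q * α * β)
  · simp

theorem theorem1p1 (m n t : ℕ) (hm : 0 < m) (hn : 0 < n)
    (ht₁ : m * (m + 1) / 2 ≤ t) (ht₂ : t ≤ m * (m + 1) / 2 + m * n) :
    ∑ X ∈ (Finset.powersetCard m (Finset.Icc 1 (m + n))).filter (fun X => ∑ x ∈ X, x = t),
        vandermondeOf X * vandermondeOf (Finset.Icc 1 (m + n) \ X) =
      (barnesG (m + 1) : ℤ) * (barnesG (n + 1) : ℤ) *
        (Nat.choose (m * n) (t - m * (m + 1) / 2) : ℤ) := by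
  have huniv : Finset.Icc 1 (m + n) = Finset.univ.map (finSuccEmb (m + n)) := by
    ext x
    simp only [Finset.mem_Icc, Finset.mem_map, Finset.mem_univ, true_and, finSuccEmb]
    constructor
    · intro h
      exact ⟨⟨x - 1, by omega⟩, Nat.sub_add_cancel h.1⟩
    · rintro ⟨y, rfl⟩
      exact ⟨Nat.succ_pos _, y.2⟩
  set c := ∑ i : Fin m, (i : ℕ) with hc
  have hcm : m * (m + 1) / 2 = c + m := by
    have h := Finset.sum_range_id_mul_two (m + 1)
    rw [Finset.sum_range_succ, Finset.sum_range, ← hc, Nat.add_sub_cancel, mul_comm (m + 1)] at h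
    omega
  -- Shifting the elements of `Fin (m + n)` by one raises the sum of an `m`-element set by `m`.
  have hgen := congrArg (fun p => p.coeff (t - m)) (sum_det_choose_mul_X_pow m n)
  have hcoeff : t - m = (t - (c + m)) + c := by omega
  simp only [← hc] at hgen
  rw [mul_comm, hcoeff, Polynomial.coeff_mul_X_pow, Polynomial.coeff_one_add_X_pow] at hgen
  rw [hcm] at ht₁ ⊢
  rw [← hgen, Polynomial.finsetSum_coeff, Finset.mul_sum, huniv, Finset.sum_filter,
    Finset.powersetCard_map, Finset.sum_map, Finset.powersetCard_eq_filter, Finset.powerset_univ,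
    Finset.sum_filter]
  refine Finset.sum_congr rfl fun s _ => ?_
  by_cases h : s.card = m
  · have hsum : ∑ x ∈ s.map (finSuccEmb (m + n)), x = ∑ x ∈ s, (x : ℕ) + m := by
      rw [Finset.sum_map]
      change ∑ x ∈ s, ((x : ℕ) + 1) = _
      simp [Finset.sum_add_distrib, h]
    simp only [dif_pos h, if_pos h, RelEmbedding.coe_toEmbedding, Finset.mapEmbedding_apply, ← Finset.map_sdiff,
      hsum, ← Finset.compl_eq_univ_sdiff, Polynomial.coeff_C_mul_X_pow,
      vandermondeOf_map_finSuccEmb s h,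
      vandermondeOf_map_finSuccEmb sᶜ (card_compl_of_card_eq h)]
    split_ifs <;> first | omega | ring
  · simp [h]
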